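/- A \emph{prop} is a strict symmetric monoidal category whose objects are the natural numbers, with $n\oplus m=n+m$ and unit $0$; props form a category $\mathbf{PROP}$ whose morphisms are the identity-on-objects strict symmetric monoidal functors. An \emph{abelian prop} is a prop whose underlying category is abelian and whose monoidal product is the biproduct. Let $\mathcal C$ be an abelian prop, and let - $\mathcal C+\mathcal C^{op}$ be the coproduct of $\mathcal C$ and its opposite prop in $\mathbf{PROP}$; - $\mathrm{Span}(\mathcal C)$ (resp. $\mathrm{Cospan}(\mathcal C)$) be the prop whose arrows $n\to m$ are isomorphism classes of spans $n\leftarrow z\to m$ (resp. cospans $n\to z\leftarrow m$) in $\mathcal C$, composed by pullback (resp. pushout); - $\mathrm{Rel}(\mathcal C)$ (resp. $\mathrm{Corel}(\mathcal C)$) be the prop of relations (resp. corelations) for the epi-mono factorisation system: its arrows are the equivalence classes of spans (resp. cospans) for the equivalence relation generated by identifying two spans (resp. cospans) whenever there is an epimorphism (resp. a monomorphism) between their apices commuting with the legs; composition is by pullback (resp. pushout). In all of them the monoidal product is computed componentwise. Let $\mathcal C+\mathcal C^{op}\to\mathrm{Span}(\mathcal C)$ be induced by $f\mapsto(\xleftarrow{\mathrm{id}}\xrightarrow{f})$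 on $\mathcal C$ and $g\mapsto(\xleftarrow{g}\xrightarrow{\mathrm{id}})$ on $\mathcal C^{op}$, and let $\mathcal C+\mathcal C^{op}\to\mathrm{Cospan}(\mathcal C)$ be induced by $f\mapsto(\xrightarrow{f}\xleftarrow{\mathrm{id}})$ and $g\mapsto(\xrightarrow{\mathrm{id}}\xleftarrow{g})$. Let $\Gamma:\mathrm{Cospan}(\mathcal C)\to\mathrm{Corel}(\mathcal C)$ send a cospan to the corelation it represents, and let $\Pi:\mathrm{Span}(\mathcal C)\to\mathrm{Corel}(\mathcal C)$ send a span to the corelation represented by its pushout; these are morphisms of props. Then the square $$\begin{array}{ccc}\mathcal C+\mathcal C^{op}&\to&\mathrm{Span}(\mathcal C)\\ \downarrow&&\downarrow{\scriptstyle\Pi}\\ \mathrm{Cospan}(\mathcal C)&\xrightarrow{\ \Gamma\ }&\mathrm{Corel}(\mathcal C)\end{array}$$ is a pushout in $\mathbf{PROP}$. Moreover there is an isomorphism of props $\mathrm{Corel}(\mathcal C)\cong\mathrm{Rel}(\mathcal C)$ which carries $\Pi$ to the morphism $\mathrm{Span}(\mathcal C)\to\mathrm{Rel}(\mathcal C)$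 sending a span to the relation it represents, and $\Gamma$ to the morphism $\mathrm{Cospan}(\mathcal C)\to\mathrm{Rel}(\mathcal C)$ sending a cospan to the relation represented by its pullback. -/

import Mathlib

open CategoryTheory CategoryTheory.Limits

universe v

/-- A category whose objects are the natural numbers. Composition is in diagrammatic order. -/
structure NatCategory where
  Hom : ℕ → ℕ → Type v
  id : ∀ a, Hom a a
  comp : ∀ {a b c}, Hom a b → Hom b c → Hom a c
  id_comp : ∀ {a b} (f : Hom a b), comp (id a) f = f
  comp_id : ∀ {a b} (f : Hom a b), comp f (id b) = f
  assoc : ∀ {a b c d} (f : Hom a b) (g : Hom b c) (h : Hom c d),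
    comp (comp f g) h = comp f (comp g h)

namespace NatCategory

attribute [simp] id_comp comp_id assoc

/-- The identity morphism, seen as a morphism between two equal objects. -/
def eqHom (P : NatCategory.{v}) {a b : ℕ} (h : a = b) : P.Hom a b := h ▸ P.id a

@[simp] theorem eqHom_rfl (P : NatCategory.{v}) (a : ℕ) (h : a = a) : P.eqHom h = P.id a := rfl

end NatCategory

/-- A prop: a strict symmetric monoidal category whose objects are the natural numbers, with
`n ⊗ m = n + m` and unit object `0`. Strictness means that the associators and the unitors are
identities; `symm a b` is the symmetry `a ⊗ b ⟶ b ⊗ a`. -/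
structure PROP extends NatCategory.{v} where
  tensor : ∀ {a b c d}, Hom a b → Hom c d → Hom (a + c) (b + d)
  symm : ∀ a b, Hom (a + b) (b + a)
  tensor_id : ∀ a b, tensor (id a) (id b) = id (a + b)
  tensor_comp : ∀ {a b c a' b' c'} (f : Hom a b) (g : Hom b c) (f' : Hom a' b') (g' : Hom b' c'),
    tensor (comp f g) (comp f' g') = comp (tensor f f') (tensor g g')
  tensor_unit : ∀ {a b} (f : Hom a b), tensor f (id 0) = f
  unit_tensor : ∀ {a b} (f : Hom a b),
    comp (tensor (id 0) f) (toNatCategory.eqHom (Nat.zero_add b)) =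
      comp (toNatCategory.eqHom (Nat.zero_add a)) f
  tensor_assoc : ∀ {a b c d k l} (f : Hom a b) (g : Hom c d) (h : Hom k l),
    comp (tensor (tensor f g) h) (toNatCategory.eqHom (Nat.add_assoc b d l)) =
      comp (toNatCategory.eqHom (Nat.add_assoc a c k)) (tensor f (tensor g h))
  symm_natural : ∀ {a b c d} (f : Hom a b) (g : Hom c d),
    comp (tensor f g) (symm b d) = comp (symm a c) (tensor g f)
  symm_symm : ∀ a b, comp (symm a b) (symm b a) = id (a + b)
  hexagon : ∀ a b c, symm a (b + c) =
    comp (toNatCategory.eqHom (Nat.add_assoc a b c).symm)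
      (comp (tensor (symm a b) (id c))
        (comp (toNatCategory.eqHom (Nat.add_assoc b a c))
          (comp (tensor (id b) (symm a c))
            (toNatCategory.eqHom (Nat.add_assoc b c a).symm))))

namespace PROP

/-- A morphism of props: an identity-on-objects strict symmetric monoidal functor. -/
@[ext]
structure Morphism (P Q : PROP.{v}) where
  map : ∀ {a b}, P.Hom a b → Q.Hom a b
  map_id : ∀ a, map (P.id a) = Q.id a
  map_comp : ∀ {a b c} (f : P.Hom a b) (g : P.Hom b c), map (P.comp f g) = Q.comp (map f) (map g)
  map_tensor : ∀ {a b c d} (f : P.Hom a b) (g : P.Hom c d),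
    map (P.tensor f g) = Q.tensor (map f) (map g)
  map_symm : ∀ a b, map (P.symm a b) = Q.symm a b

/-- The category of props. -/
instance : Category PROP.{v} where
  Hom P Q := Morphism P Q
  id P := ⟨fun f => f, fun _ => rfl, fun _ _ => rfl, fun _ _ => rfl, fun _ _ => rfl⟩
  comp F G := ⟨fun f => G.map (F.map f), fun a => by rw [F.map_id, G.map_id],
    fun f g => by rw [F.map_comp, G.map_comp], fun f g => by rw [F.map_tensor, G.map_tensor],
    fun a b => by rw [F.map_symm, G.map_symm]⟩

/-- The underlying map on arrows of a morphism of props. -/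
def app {P Q : PROP.{v}} (F : P ⟶ Q) {a b : ℕ} (f : P.Hom a b) : Q.Hom a b := Morphism.map F f

section
variable {P Q R : PROP.{v}}

theorem hom_ext {F G : P ⟶ Q} (h : ∀ {a b} (f : P.Hom a b), app F f = app G f) : F = G :=
  Morphism.ext (by funext a b f; exact h f)

@[simp] theorem app_id (F : P ⟶ Q) (a : ℕ) : app F (P.id a) = Q.id a := Morphism.map_id F a
@[simp] theorem app_comp (F : P ⟶ Q) {a b c : ℕ} (f : P.Hom a b) (g : P.Hom b c) :
    app F (P.comp f g) = Q.comp (app F f) (app F g) := Morphism.map_comp F f g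
@[simp] theorem app_tensor (F : P ⟶ Q) {a b c d : ℕ} (f : P.Hom a b) (g : P.Hom c d) :
    app F (P.tensor f g) = Q.tensor (app F f) (app F g) := Morphism.map_tensor F f g
@[simp] theorem app_symm (F : P ⟶ Q) (a b : ℕ) : app F (P.symm a b) = Q.symm a b :=
  Morphism.map_symm F a b
@[simp] theorem app_eqHom (F : P ⟶ Q) {a b : ℕ} (h : a = b) : app F (P.eqHom h) = Q.eqHom h := by
  subst h; simp
@[simp] theorem comp_app (F : P ⟶ Q) (G : Q ⟶ R) {a b : ℕ} (f : P.Hom a b) :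
    app (F ≫ G) f = app G (app F f) := rfl
@[simp] theorem id_app {a b : ℕ} (f : P.Hom a b) : app (𝟙 P) f = f := rfl

end

theorem eqHom_comp_eqHom (P : PROP.{v}) {a b c : ℕ} (h : a = b) (k : b = c) :
    P.comp (P.eqHom h) (P.eqHom k) = P.eqHom (h.trans k) := by
  subst h; subst k; simp

theorem eqHom_comp_eqHom_assoc (P : PROP.{v}) {a b c d : ℕ} (h : a = b) (k : b = c)
    (f : P.Hom c d) :
    P.comp (P.eqHom h) (P.comp (P.eqHom k) f) = P.comp (P.eqHom (h.trans k)) f := by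
  subst h; subst k; simp

/-- Two morphisms with a left inverse and a right inverse determine each other. -/
theorem inv_unique (P : PROP.{v}) {a b : ℕ} {f : P.Hom a b} {g h : P.Hom b a}
    (hg : P.comp g f = P.id b) (hh : P.comp f h = P.id a) : g = h := by
  rw [← P.comp_id g, ← hh, ← P.assoc, hg, P.id_comp]

theorem eqHom_swap (P : PROP.{v}) {a a' b b' : ℕ} (h : a = a') (k : b = b') {t : P.Hom a b}
    {f : P.Hom a' b'} (e : P.comp t (P.eqHom k) = P.comp (P.eqHom h) f) :
    P.comp (P.eqHom h.symm) t = P.comp f (P.eqHom k.symm) := by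
  subst h; subst k; simpa using e

/-- The opposite of a category with objects the natural numbers. -/
def _root_.NatCategory.op (P : NatCategory.{v}) : NatCategory.{v} where
  Hom a b := P.Hom b a
  id := P.id
  comp f g := P.comp g f
  id_comp := P.comp_id
  comp_id := P.id_comp
  assoc f g h := (P.assoc h g f).symm

theorem _root_.NatCategory.op_eqHom (P : NatCategory.{v}) {a b : ℕ} (h : a = b) :
    P.op.eqHom h = P.eqHom h.symm := by
  subst h; rfl

/-- The opposite prop, with the same tensor product. -/
def op (P : PROP.{v}) : PROP.{v} where
  toNatCategory := P.toNatCategory.op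
  tensor f g := P.tensor f g
  symm a b := P.symm b a
  tensor_id := P.tensor_id
  tensor_comp f g f' g' := P.tensor_comp g f g' f'
  tensor_unit := P.tensor_unit
  unit_tensor {a b} f := by
    rw [NatCategory.op_eqHom, NatCategory.op_eqHom]
    change P.comp (P.eqHom _) (P.tensor (P.id 0) f) = P.comp f (P.eqHom _)
    exact P.eqHom_swap _ _ (P.unit_tensor (a := b) (b := a) f)
  tensor_assoc {a b c d k l} f g h := by
    rw [NatCategory.op_eqHom, NatCategory.op_eqHom]
    change P.comp (P.eqHom _) (P.tensor (P.tensor f g) h) =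
      P.comp (P.tensor f (P.tensor g h)) (P.eqHom _)
    exact P.eqHom_swap _ _ (P.tensor_assoc f g h)
  symm_natural f g := (P.symm_natural g f).symm
  symm_symm a b := P.symm_symm a b
  hexagon a b c := by
    simp only [NatCategory.op_eqHom]
    change P.symm (b + c) a = P.comp (P.comp (P.comp (P.comp (P.eqHom _)
      (P.tensor (P.id b) (P.symm c a))) (P.eqHom _)) (P.tensor (P.symm b a) (P.id c))) (P.eqHom _)
    have hl (x y : ℕ) : P.comp (P.tensor (P.id x) (P.symm a y)) (P.tensor (P.id x) (P.symm y a)) =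
        P.id _ := by
      rw [← P.tensor_comp, P.symm_symm, P.id_comp, P.tensor_id]
    have hr (x y : ℕ) : P.comp (P.tensor (P.symm a x) (P.id y)) (P.tensor (P.symm x a) (P.id y)) =
        P.id _ := by
      rw [← P.tensor_comp, P.symm_symm, P.id_comp, P.tensor_id]
    refine P.inv_unique (f := P.symm a (b + c)) (P.symm_symm _ _) ?_
    rw [P.hexagon]
    simp only [P.assoc, eqHom_comp_eqHom_assoc, NatCategory.eqHom_rfl, P.id_comp]
    rw [← P.assoc (P.tensor (P.id b) (P.symm a c)), hl, P.id_comp, eqHom_comp_eqHom_assoc,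
      NatCategory.eqHom_rfl, P.id_comp, ← P.assoc (P.tensor (P.symm a b) (P.id c)), hr, P.id_comp,
      eqHom_comp_eqHom, NatCategory.eqHom_rfl]

/-- The opposite is an involution, definitionally. -/
theorem op_op (P : PROP.{v}) : P.op.op = P := rfl


/-! ### Coproducts of props -/

section Coproduct

variable (P Q : PROP.{v})

/-- Formal composites and tensor products of arrows of `P` and of `Q`. -/
inductive CoprodTerm : ℕ → ℕ → Type v
  | inl {a b : ℕ} (f : P.Hom a b) : CoprodTerm a b
  | inr {a b : ℕ} (g : Q.Hom a b) : CoprodTerm a b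
  | comp {a b c : ℕ} (s : CoprodTerm a b) (t : CoprodTerm b c) : CoprodTerm a c
  | tensor {a b c d : ℕ} (s : CoprodTerm a b) (t : CoprodTerm c d) : CoprodTerm (a + c) (b + d)

variable {P Q}

/-- The smallest congruence for which the quotient of the formal terms is a prop and the two
inclusions are morphisms of props. -/
inductive CoprodRel : ∀ {a b : ℕ}, CoprodTerm P Q a b → CoprodTerm P Q a b → Prop
  | refl {a b : ℕ} (s : CoprodTerm P Q a b) : CoprodRel s s
  | symm {a b : ℕ} {s t : CoprodTerm P Q a b} : CoprodRel s t → CoprodRel t s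
  | trans {a b : ℕ} {s t u : CoprodTerm P Q a b} : CoprodRel s t → CoprodRel t u → CoprodRel s u
  | comp_congr {a b c : ℕ} {s s' : CoprodTerm P Q a b} {t t' : CoprodTerm P Q b c} :
      CoprodRel s s' → CoprodRel t t' → CoprodRel (.comp s t) (.comp s' t')
  | tensor_congr {a b c d : ℕ} {s s' : CoprodTerm P Q a b} {t t' : CoprodTerm P Q c d} :
      CoprodRel s s' → CoprodRel t t' → CoprodRel (.tensor s t) (.tensor s' t')
  | inl_comp {a b c : ℕ} (f : P.Hom a b) (g : P.Hom b c) :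
      CoprodRel (.inl (P.comp f g)) (.comp (.inl f) (.inl g))
  | inr_comp {a b c : ℕ} (f : Q.Hom a b) (g : Q.Hom b c) :
      CoprodRel (.inr (Q.comp f g)) (.comp (.inr f) (.inr g))
  | inl_tensor {a b c d : ℕ} (f : P.Hom a b) (g : P.Hom c d) :
      CoprodRel (.inl (P.tensor f g)) (.tensor (.inl f) (.inl g))
  | inr_tensor {a b c d : ℕ} (f : Q.Hom a b) (g : Q.Hom c d) :
      CoprodRel (.inr (Q.tensor f g)) (.tensor (.inr f) (.inr g))
  | id_eq (a : ℕ) : CoprodRel (.inl (P.id a)) (.inr (Q.id a))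
  | symm_eq (a b : ℕ) : CoprodRel (.inl (P.symm a b)) (.inr (Q.symm a b))
  | id_comp {a b : ℕ} (s : CoprodTerm P Q a b) : CoprodRel (.comp (.inl (P.id a)) s) s
  | comp_id {a b : ℕ} (s : CoprodTerm P Q a b) : CoprodRel (.comp s (.inl (P.id b))) s
  | assoc {a b c d : ℕ} (s : CoprodTerm P Q a b) (t : CoprodTerm P Q b c)
      (u : CoprodTerm P Q c d) : CoprodRel (.comp (.comp s t) u) (.comp s (.comp t u))
  | tensor_comp {a b c a' b' c' : ℕ} (s : CoprodTerm P Q a b) (t : CoprodTerm P Q b c)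
      (s' : CoprodTerm P Q a' b') (t' : CoprodTerm P Q b' c') :
      CoprodRel (.tensor (.comp s t) (.comp s' t')) (.comp (.tensor s s') (.tensor t t'))
  | tensor_unit {a b : ℕ} (s : CoprodTerm P Q a b) : CoprodRel (.tensor s (.inl (P.id 0))) s
  | unit_tensor {a b : ℕ} (s : CoprodTerm P Q a b) :
      CoprodRel (.comp (.tensor (.inl (P.id 0)) s) (.inl (P.eqHom (Nat.zero_add b))))
        (.comp (.inl (P.eqHom (Nat.zero_add a))) s)
  | tensor_assoc {a b c d k l : ℕ} (s : CoprodTerm P Q a b) (t : CoprodTerm P Q c d)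
      (u : CoprodTerm P Q k l) :
      CoprodRel (.comp (.tensor (.tensor s t) u) (.inl (P.eqHom (Nat.add_assoc b d l))))
        (.comp (.inl (P.eqHom (Nat.add_assoc a c k))) (.tensor s (.tensor t u)))
  | symm_natural {a b c d : ℕ} (s : CoprodTerm P Q a b) (t : CoprodTerm P Q c d) :
      CoprodRel (.comp (.tensor s t) (.inl (P.symm b d))) (.comp (.inl (P.symm a c)) (.tensor t s))

variable (P Q)

/-- Arrows of the coproduct. -/
def CoprodHom (a b : ℕ) : Type v := Quot (CoprodRel (P := P) (Q := Q) (a := a) (b := b))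

/-- The underlying category of the coproduct. -/
def coprodCat : NatCategory.{v} where
  Hom := CoprodHom P Q
  id a := Quot.mk _ (.inl (P.id a))
  comp := Quot.map₂ CoprodTerm.comp (fun _ _ _ h => .comp_congr (.refl _) h)
    (fun _ _ _ h => .comp_congr h (.refl _))
  id_comp := by rintro a b ⟨f⟩; exact Quot.sound (.id_comp f)
  comp_id := by rintro a b ⟨f⟩; exact Quot.sound (.comp_id f)
  assoc := by rintro a b c d ⟨f⟩ ⟨g⟩ ⟨h⟩; exact Quot.sound (.assoc f g h)

theorem coprodCat_eqHom {a b : ℕ} (h : a = b) :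
    (coprodCat P Q).eqHom h = Quot.mk _ (.inl (P.eqHom h)) := by
  subst h; rfl

/-- The prop generated by the arrows of `P` and of `Q`, subject to the equations that hold in `P`,
those that hold in `Q`, and the laws of props. -/
def coprodProp : PROP.{v} where
  toNatCategory := coprodCat P Q
  tensor := Quot.map₂ CoprodTerm.tensor (fun _ _ _ h => .tensor_congr (.refl _) h)
    (fun _ _ _ h => .tensor_congr h (.refl _))
  symm a b := Quot.mk _ (.inl (P.symm a b))
  tensor_id a b := Quot.sound ((CoprodRel.inl_tensor _ _).symm.trans
    (by rw [P.tensor_id]; exact .refl _))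
  tensor_comp := by
    rintro a b c a' b' c' ⟨f⟩ ⟨g⟩ ⟨f'⟩ ⟨g'⟩; exact Quot.sound (.tensor_comp f g f' g')
  tensor_unit := by rintro a b ⟨f⟩; exact Quot.sound (.tensor_unit f)
  unit_tensor := by
    rintro a b ⟨f⟩
    rw [coprodCat_eqHom, coprodCat_eqHom]
    exact Quot.sound (.unit_tensor f)
  tensor_assoc := by
    rintro a b c d k l ⟨f⟩ ⟨g⟩ ⟨h⟩
    rw [coprodCat_eqHom, coprodCat_eqHom]
    exact Quot.sound (.tensor_assoc f g h)
  symm_natural := by rintro a b c d ⟨f⟩ ⟨g⟩; exact Quot.sound (.symm_natural f g)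
  symm_symm a b := Quot.sound ((CoprodRel.inl_comp _ _).symm.trans
    (by rw [P.symm_symm]; exact .refl _))
  hexagon a b c := by
    simp only [coprodCat_eqHom]
    refine Quot.sound ?_
    rw [P.hexagon]
    refine .trans (.inl_comp _ _) (.comp_congr (.refl _) ?_)
    refine .trans (.inl_comp _ _) (.comp_congr (.inl_tensor _ _) ?_)
    refine .trans (.inl_comp _ _) (.comp_congr (.refl _) ?_)
    exact .trans (.inl_comp _ _) (.comp_congr (.inl_tensor _ _) (.refl _))

/-- The first injection into the coproduct. -/
def coprodInl : P ⟶ coprodProp P Q where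
  map f := Quot.mk _ (.inl f)
  map_id _ := rfl
  map_comp f g := Quot.sound (.inl_comp f g)
  map_tensor f g := Quot.sound (.inl_tensor f g)
  map_symm _ _ := rfl

/-- The second injection into the coproduct. -/
def coprodInr : Q ⟶ coprodProp P Q where
  map f := Quot.mk _ (.inr f)
  map_id a := (Quot.sound (.id_eq a)).symm
  map_comp f g := Quot.sound (.inr_comp f g)
  map_tensor f g := Quot.sound (.inr_tensor f g)
  map_symm a b := (Quot.sound (.symm_eq a b)).symm

variable {P Q} {X : PROP.{v}}

/-- Evaluation of formal terms. -/
def coprodEval (F : P ⟶ X) (G : Q ⟶ X) : ∀ {a b : ℕ}, CoprodTerm P Q a b → X.Hom a b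
  | _, _, .inl f => app F f
  | _, _, .inr g => app G g
  | _, _, .comp s t => X.comp (coprodEval F G s) (coprodEval F G t)
  | _, _, .tensor s t => X.tensor (coprodEval F G s) (coprodEval F G t)

theorem coprodEval_rel (F : P ⟶ X) (G : Q ⟶ X) {a b : ℕ} {s t : CoprodTerm P Q a b}
    (h : CoprodRel s t) : coprodEval F G s = coprodEval F G t := by
  induction h with
  | refl => rfl
  | symm _ ih => exact ih.symm
  | trans _ _ ih ih' => exact ih.trans ih'
  | comp_congr _ _ ih ih' => simp only [coprodEval, ih, ih']
  | tensor_congr _ _ ih ih' => simp only [coprodEval, ih, ih']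
  | tensor_comp => simp only [coprodEval, X.tensor_comp]
  | tensor_unit => simp only [coprodEval, app_id, X.tensor_unit]
  | unit_tensor => simp only [coprodEval, app_id, app_eqHom, X.unit_tensor]
  | tensor_assoc => simp only [coprodEval, app_eqHom, X.tensor_assoc]
  | symm_natural => simp only [coprodEval, app_symm, X.symm_natural]
  | _ => simp [coprodEval]

/-- The morphism out of the coproduct induced by two morphisms. -/
def coprodDesc (F : P ⟶ X) (G : Q ⟶ X) : coprodProp P Q ⟶ X where
  map f := Quot.lift (coprodEval F G) (fun _ _ h => coprodEval_rel F G h) f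
  map_id a := app_id F a
  map_comp := by rintro a b c ⟨f⟩ ⟨g⟩; rfl
  map_tensor := by rintro a b c d ⟨f⟩ ⟨g⟩; rfl
  map_symm a b := app_symm F a b

theorem coprod_hom_ext {F G : coprodProp P Q ⟶ X}
    (hl : coprodInl P Q ≫ F = coprodInl P Q ≫ G) (hr : coprodInr P Q ≫ F = coprodInr P Q ≫ G) :
    F = G := by
  refine hom_ext fun {a b} f => ?_
  obtain ⟨s, rfl⟩ := Quot.exists_rep f
  induction s with
  | inl f => exact congrArg (fun H => app H f) hl
  | inr g => exact congrArg (fun H => app H g) hr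
  | comp s t hs ht =>
    exact (app_comp F (Quot.mk _ s) (Quot.mk _ t)).trans
      ((congrArg₂ X.comp hs ht).trans (app_comp G (Quot.mk _ s) (Quot.mk _ t)).symm)
  | tensor s t hs ht =>
    exact (app_tensor F (Quot.mk _ s) (Quot.mk _ t)).trans
      ((congrArg₂ X.tensor hs ht).trans (app_tensor G (Quot.mk _ s) (Quot.mk _ t)).symm)

/-- The category of props has binary coproducts. -/
instance : HasBinaryCoproducts PROP.{v} :=
  @hasBinaryCoproducts_of_hasColimit_pair _ _ fun {P Q} =>
    ⟨⟨⟨BinaryCofan.mk (coprodInl P Q) (coprodInr P Q),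
      BinaryCofan.IsColimit.mk _ (fun F G => coprodDesc F G) (fun _ _ => rfl) (fun _ _ => rfl)
        (fun _ _ _ hl hr => coprod_hom_ext hl hr)⟩⟩⟩

end Coproduct

/-! ### Abelian props -/

/-- The underlying category of a prop, as a category in the sense of Mathlib. -/
def Ob (_ : PROP.{v}) : Type := ℕ

/-- The natural number `n`, seen as an object of a prop. -/
def ob (P : PROP.{v}) (n : ℕ) : P.Ob := n

instance (P : PROP.{v}) : Category.{v} P.Ob where
  Hom := P.Hom
  id := P.id
  comp := P.comp
  id_comp := P.id_comp
  comp_id := P.comp_id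
  assoc := P.assoc

/-- An arrow of a prop, seen as an arrow of its underlying category. -/
def ar (P : PROP.{v}) {a b : ℕ} (f : P.Hom a b) : P.ob a ⟶ P.ob b := f

/-- An abelian prop: the underlying category is abelian and the monoidal product is the
biproduct. -/
class IsAbelian (P : PROP.{v}) : Prop where
  exists_biproduct : ∃ (_ : Abelian P.Ob)
    (φ : ∀ m n : ℕ, P.ob (m + n) ≅ P.ob m ⊞ P.ob n),
    ∀ {a b c d : ℕ} (f : P.Hom a b) (g : P.Hom c d),
      P.ar (P.tensor f g) ≫ (φ b d).hom = (φ a c).hom ≫ biprod.map (P.ar f) (P.ar g)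

/-- The functor comparing the underlying category of the opposite prop with the opposite
category. -/
def opFunctor (P : PROP.{v}) : P.op.Ob ⥤ P.Obᵒᵖ where
  obj n := Opposite.op (P.ob n)
  map f := Quiver.Hom.op (P.ar f)

instance (P : PROP.{v}) : P.opFunctor.Full where
  map_surjective f := ⟨f.unop, rfl⟩
instance (P : PROP.{v}) : P.opFunctor.Faithful where
  map_injective h := Quiver.Hom.op_inj h
instance (P : PROP.{v}) : P.opFunctor.EssSurj where
  mem_essImage n := ⟨n.unop, ⟨Iso.refl _⟩⟩
instance (P : PROP.{v}) : P.opFunctor.IsEquivalence where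

/-- The opposite category of an abelian category is abelian. -/
noncomputable abbrev opAbelian (P : PROP.{v}) [Abelian P.Ob] : Abelian P.op.Ob :=
  letI : Preadditive P.op.Ob := .ofFullyFaithful (.ofFullyFaithful P.opFunctor)
  haveI : HasFiniteProducts P.op.Ob := ⟨fun _ =>
    Adjunction.hasLimitsOfShape_of_equivalence P.opFunctor⟩
  abelianOfEquivalence P.opFunctor

theorem isAbelian_of_product (P : PROP.{v}) [Abelian P.Ob]
    (fst : ∀ m n : ℕ, P.ob (m + n) ⟶ P.ob m) (snd : ∀ m n : ℕ, P.ob (m + n) ⟶ P.ob n)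
    (lift : ∀ (m n : ℕ) (X : P.Ob) (u : X ⟶ P.ob m) (v : X ⟶ P.ob n),
      ∃ w : X ⟶ P.ob (m + n), w ≫ fst m n = u ∧ w ≫ snd m n = v)
    (ext : ∀ (m n : ℕ) (X : P.Ob) (w w' : X ⟶ P.ob (m + n)), w ≫ fst m n = w' ≫ fst m n →
      w ≫ snd m n = w' ≫ snd m n → w = w')
    (hfst : ∀ {a b c d : ℕ} (f : P.Hom a b) (g : P.Hom c d),
      P.ar (P.tensor f g) ≫ fst b d = fst a c ≫ P.ar f)
    (hsnd : ∀ {a b c d : ℕ} (f : P.Hom a b) (g : P.Hom c d),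
      P.ar (P.tensor f g) ≫ snd b d = snd a c ≫ P.ar g) : P.IsAbelian := by
  choose w hw using fun m n => lift m n _ (biprod.fst : P.ob m ⊞ P.ob n ⟶ _) biprod.snd
  refine ⟨inferInstance, fun m n => ⟨biprod.lift (fst m n) (snd m n), w m n, ?_, ?_⟩, ?_⟩
  · apply ext <;> simp [hw]
  · ext <;> simp [hw]
  · intro a b c d f g
    ext <;> simp [hfst, hsnd]

instance (P : PROP.{v}) [h : P.IsAbelian] : P.op.IsAbelian := by
  obtain ⟨_, φ, hφ⟩ := h
  let _ := P.opAbelian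
  have hφ' {a b c d : ℕ} (f : P.Hom a b) (g : P.Hom c d) :
      (φ a c).inv ≫ P.ar (P.tensor f g) = biprod.map (P.ar f) (P.ar g) ≫ (φ b d).inv := by
    rw [Iso.inv_comp_eq, ← Category.assoc, ← hφ, Category.assoc, Iso.hom_inv_id, Category.comp_id]
  have hl {a b c d : ℕ} (f : P.Hom a b) (g : P.Hom c d) :
      (biprod.inl ≫ (φ a c).inv) ≫ P.ar (P.tensor f g) = P.ar f ≫ biprod.inl ≫ (φ b d).inv := by
    rw [Category.assoc, hφ', biprod.inl_map_assoc]
  have hr {a b c d : ℕ} (f : P.Hom a b) (g : P.Hom c d) :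
      (biprod.inr ≫ (φ a c).inv) ≫ P.ar (P.tensor f g) = P.ar g ≫ biprod.inr ≫ (φ b d).inv := by
    rw [Category.assoc, hφ', biprod.inr_map_assoc]
  refine isAbelian_of_product P.op
    (fun m n => (biprod.inl ≫ (φ m n).inv : P.ob m ⟶ P.ob (m + n)))
    (fun m n => (biprod.inr ≫ (φ m n).inv : P.ob n ⟶ P.ob (m + n))) ?_ ?_ ?_ ?_
  · intro m n X u v
    let u' : P.ob m ⟶ P.ob X := u
    let v' : P.ob n ⟶ P.ob X := v
    refine ⟨((φ m n).hom ≫ biprod.desc u' v' : P.ob (m + n) ⟶ P.ob X), ?_, ?_⟩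
    · change (biprod.inl ≫ (φ m n).inv) ≫ (φ m n).hom ≫ biprod.desc u' v' = u'
      simp
    · change (biprod.inr ≫ (φ m n).inv) ≫ (φ m n).hom ≫ biprod.desc u' v' = v'
      simp
  · intro m n X w w' h h'
    let u : P.ob (m + n) ⟶ P.ob X := w
    let u' : P.ob (m + n) ⟶ P.ob X := w'
    change (biprod.inl ≫ (φ m n).inv) ≫ u = (biprod.inl ≫ (φ m n).inv) ≫ u' at h
    change (biprod.inr ≫ (φ m n).inv) ≫ u = (biprod.inr ≫ (φ m n).inv) ≫ u' at h'
    change u = u'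
    rw [← cancel_epi (φ m n).inv]
    ext
    · simpa using h
    · simpa using h'
  · intro a b c d f g
    exact hl (a := b) (b := a) (c := d) (d := c) f g
  · intro a b c d f g
    exact hr (a := b) (b := a) (c := d) (d := c) f g


/-! ### Spans -/

/-- Pullbacks exist in `P`, and the monoidal product preserves them. -/
class HasSpans (P : PROP.{v}) : Prop where
  hasPullbacks : HasPullbacks P.Ob
  tensor_isPullback : ∀ {a b c d a' b' c' d' : ℕ}
    {p : P.Hom a b} {q : P.Hom a c} {f : P.Hom b d} {g : P.Hom c d}
    {p' : P.Hom a' b'} {q' : P.Hom a' c'} {f' : P.Hom b' d'} {g' : P.Hom c' d'},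
    IsPullback (P.ar p) (P.ar q) (P.ar f) (P.ar g) →
    IsPullback (P.ar p') (P.ar q') (P.ar f') (P.ar g') →
    IsPullback (P.ar (P.tensor p p')) (P.ar (P.tensor q q')) (P.ar (P.tensor f f'))
      (P.ar (P.tensor g g'))

attribute [instance] HasSpans.hasPullbacks

/-- A class of arrows containing the isomorphisms, stable under pullback and closed under the
monoidal product. -/
class SpanClass (P : PROP.{v}) (W : MorphismProperty P.Ob) : Prop where
  of_isIso : ∀ {X Y : P.Ob} (f : X ⟶ Y), IsIso f → W f
  isStableUnderBaseChange : W.IsStableUnderBaseChange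
  tensor : ∀ {a b c d : ℕ} (f : P.Hom a b) (g : P.Hom c d), W (P.ar f) → W (P.ar g) →
    W (P.ar (P.tensor f g))

attribute [instance] SpanClass.isStableUnderBaseChange

/-- A span `a ⟵ apex ⟶ b` in a prop. -/
structure RawSpan (P : PROP.{v}) (a b : ℕ) where
  apex : ℕ
  left : P.Hom apex a
  right : P.Hom apex b

theorem isIso_eqHom (P : PROP.{v}) {a b : ℕ} (h : a = b) : IsIso (P.ar (P.eqHom h)) := by
  subst h; exact inferInstanceAs (IsIso (𝟙 (P.ob a)))

theorem isIso_symm (P : PROP.{v}) (a b : ℕ) : IsIso (P.ar (P.symm a b)) :=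
  ⟨P.ar (P.symm b a), P.symm_symm a b, P.symm_symm b a⟩

section SpanMod

variable {P : PROP.{v}}

/-- Two spans are related if there is an arrow in `W` between their apices, compatible with the
legs. -/
def SpanRel (W : MorphismProperty P.Ob) {a b : ℕ} (s t : RawSpan P a b) : Prop :=
  ∃ e : P.Hom s.apex t.apex, W (P.ar e) ∧ P.comp e t.left = s.left ∧ P.comp e t.right = s.right

/-- Spans from `a` to `b`, modulo the equivalence relation generated by `SpanRel W`. -/
def SpanHom (W : MorphismProperty P.Ob) (a b : ℕ) : Type v :=
  Quot (SpanRel W (a := a) (b := b))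

/-- The class of the span `a ⟵ n ⟶ b` with legs `f` and `g`. -/
def SpanHom.mk (W : MorphismProperty P.Ob) {a b n : ℕ} (f : P.Hom n a) (g : P.Hom n b) :
    SpanHom W a b := Quot.mk _ ⟨n, f, g⟩

variable {W : MorphismProperty P.Ob}

theorem SpanHom.ind {a b : ℕ} (s : SpanHom W a b) :
    ∃ (n : ℕ) (f : P.Hom n a) (g : P.Hom n b), s = SpanHom.mk W f g := by
  obtain ⟨⟨n, f, g⟩, rfl⟩ := Quot.exists_rep s
  exact ⟨n, f, g, rfl⟩

theorem SpanHom.eq_of {a b n m : ℕ} (e : P.Hom n m) (he : W (P.ar e)) {f : P.Hom m a}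
    {g : P.Hom m b} {f' : P.Hom n a} {g' : P.Hom n b} (hf : P.comp e f = f')
    (hg : P.comp e g = g') : SpanHom.mk W f' g' = SpanHom.mk W f g :=
  Quot.sound ⟨e, he, hf, hg⟩

/-- The composite of two spans, computed by a pullback. -/
noncomputable def RawSpan.comp [P.HasSpans] {a b c : ℕ} (s : RawSpan P a b) (t : RawSpan P b c) :
    RawSpan P a c where
  apex := (pullback (P.ar s.right) (P.ar t.left) : P.Ob)
  left := P.comp (pullback.fst (P.ar s.right) (P.ar t.left)) s.left
  right := P.comp (pullback.snd (P.ar s.right) (P.ar t.left)) t.right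

theorem RawSpan.mk_comp [P.HasSpans] [P.SpanClass W] {a b c n m k : ℕ} {f : P.Hom n a}
    {g : P.Hom n b} {h : P.Hom m b} {i : P.Hom m c} {p : P.Hom k n} {q : P.Hom k m}
    (sq : IsPullback (P.ar p) (P.ar q) (P.ar g) (P.ar h)) :
    (Quot.mk _ (RawSpan.comp ⟨n, f, g⟩ ⟨m, h, i⟩) : SpanHom W a c) =
      SpanHom.mk W (P.comp p f) (P.comp q i) := by
  symm
  refine Quot.sound ⟨sq.isoPullback.hom, SpanClass.of_isIso _ (Iso.isIso_hom sq.isoPullback), ?_, ?_⟩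
  · exact (P.assoc _ _ _).symm.trans (congrArg (fun t => P.comp t f) sq.isoPullback_hom_fst)
  · exact (P.assoc _ _ _).symm.trans (congrArg (fun t => P.comp t i) sq.isoPullback_hom_snd)

theorem exists_isPullback [P.HasSpans] {a b c : ℕ} (f : P.Hom a c) (g : P.Hom b c) :
    ∃ (n : ℕ) (p : P.Hom n a) (q : P.Hom n b),
      IsPullback (P.ar p) (P.ar q) (P.ar f) (P.ar g) :=
  ⟨_, _, _, IsPullback.of_hasPullback (P.ar f) (P.ar g)⟩

/-- Composition of classes of spans, by pullback. -/
noncomputable def SpanHom.comp [P.HasSpans] [P.SpanClass W] {a b c : ℕ} (s : SpanHom W a b)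
    (t : SpanHom W b c) : SpanHom W a c :=
  Quot.lift₂ (fun s t => (Quot.mk _ (RawSpan.comp s t) : SpanHom W a c))
    (by
      rintro ⟨n, f, g⟩ ⟨m, h, k⟩ ⟨m', h', k'⟩ ⟨e, he, eh, ek⟩
      dsimp only at e he eh ek
      subst eh ek
      obtain ⟨A', p', q', sq'⟩ := exists_isPullback g h'
      obtain ⟨A, p, q, sq⟩ := exists_isPullback q' e
      have sq2 : IsPullback (P.ar (P.comp p p')) (P.ar q) (P.ar g) (P.ar (P.comp e h')) :=
        sq.paste_horiz sq'
      rw [RawSpan.mk_comp sq', RawSpan.mk_comp sq2]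
      refine SpanHom.eq_of p (MorphismProperty.of_isPullback sq.flip he) (P.assoc _ _ _).symm ?_
      rw [← P.assoc, ← P.assoc]
      exact congrArg (fun t => P.comp t k') sq.w)
    (by
      rintro ⟨m, h, k⟩ ⟨m', h', k'⟩ ⟨n, f, g⟩ ⟨e, he, eh, ek⟩
      dsimp only at e he eh ek
      subst eh ek
      obtain ⟨A', p', q', sq'⟩ := exists_isPullback k' f
      obtain ⟨A, p, q, sq⟩ := exists_isPullback p' e
      have sq2 : IsPullback (P.ar q) (P.ar (P.comp p q')) (P.ar (P.comp e k')) (P.ar f) :=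
        sq.flip.paste_vert sq'
      rw [RawSpan.mk_comp sq', RawSpan.mk_comp sq2]
      refine SpanHom.eq_of p (MorphismProperty.of_isPullback sq.flip he) ?_ (P.assoc _ _ _).symm
      rw [← P.assoc, ← P.assoc]
      exact congrArg (fun t => P.comp t h') sq.w)
    s t

theorem SpanHom.mk_comp_mk [P.HasSpans] [P.SpanClass W] {a b c n m k : ℕ} {f : P.Hom n a}
    {g : P.Hom n b} {h : P.Hom m b} {i : P.Hom m c} {p : P.Hom k n} {q : P.Hom k m}
    (sq : IsPullback (P.ar p) (P.ar q) (P.ar g) (P.ar h)) :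
    (SpanHom.mk W f g).comp (SpanHom.mk W h i) = SpanHom.mk W (P.comp p f) (P.comp q i) :=
  RawSpan.mk_comp sq

/-- The monoidal product of classes of spans, componentwise. -/
def SpanHom.tensor [P.SpanClass W] {a b c d : ℕ} (s : SpanHom W a b)
    (t : SpanHom W c d) : SpanHom W (a + c) (b + d) :=
  Quot.lift₂ (fun s t => SpanHom.mk W (P.tensor s.left t.left) (P.tensor s.right t.right))
    (by
      rintro ⟨n, f, g⟩ ⟨m, h, k⟩ ⟨m', h', k'⟩ ⟨e, he, eh, ek⟩
      dsimp only at e he eh ek ⊢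
      subst eh ek
      rw [← P.id_comp f, ← P.id_comp g, P.tensor_comp, P.tensor_comp, P.id_comp, P.id_comp]
      exact SpanHom.eq_of _ (SpanClass.tensor _ _
        (SpanClass.of_isIso _ (inferInstanceAs (IsIso (𝟙 (P.ob n))))) he) rfl rfl)
    (by
      rintro ⟨m, h, k⟩ ⟨m', h', k'⟩ ⟨n, f, g⟩ ⟨e, he, eh, ek⟩
      dsimp only at e he eh ek ⊢
      subst eh ek
      rw [← P.id_comp f, ← P.id_comp g, P.tensor_comp, P.tensor_comp, P.id_comp, P.id_comp]
      exact SpanHom.eq_of _ (SpanClass.tensor _ _ he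
        (SpanClass.of_isIso _ (inferInstanceAs (IsIso (𝟙 (P.ob n)))))) rfl rfl)
    s t

theorem SpanHom.mk_tensor_mk [P.SpanClass W] {a b c d n m : ℕ} (f : P.Hom n a)
    (g : P.Hom n b) (h : P.Hom m c) (i : P.Hom m d) :
    (SpanHom.mk W f g).tensor (SpanHom.mk W h i) = SpanHom.mk W (P.tensor f h) (P.tensor g i) :=
  rfl

theorem isPullback_id_left {a b : ℕ} (f : P.Hom a b) :
    IsPullback (P.ar f) (P.ar (P.id a)) (P.ar (P.id b)) (P.ar f) :=
  IsPullback.id_vert (P.ar f)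

theorem isPullback_id_right {a b : ℕ} (f : P.Hom a b) :
    IsPullback (P.ar (P.id a)) (P.ar f) (P.ar f) (P.ar (P.id b)) :=
  (isPullback_id_left f).flip

theorem SpanHom.mk_id_comp_mk [P.HasSpans] [P.SpanClass W] {a b c m : ℕ} (f : P.Hom m a)
    (g : P.Hom m b) (i : P.Hom b c) :
    (SpanHom.mk W f g).comp (SpanHom.mk W (P.id b) i) = SpanHom.mk W f (P.comp g i) := by
  rw [SpanHom.mk_comp_mk (isPullback_id_right g), P.id_comp]

theorem SpanHom.mk_comp_mk_id [P.HasSpans] [P.SpanClass W] {a b c m : ℕ} (f : P.Hom b a)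
    (g : P.Hom m b) (i : P.Hom m c) :
    (SpanHom.mk W f (P.id b)).comp (SpanHom.mk W g i) = SpanHom.mk W (P.comp g f) i := by
  rw [SpanHom.mk_comp_mk (isPullback_id_left g), P.id_comp]

end SpanMod

section SpanProp

variable (P : PROP.{v}) (W : MorphismProperty P.Ob) [P.HasSpans] [P.SpanClass W]

/-- The category of classes of spans. -/
noncomputable def spanCat : NatCategory.{v} where
  Hom := SpanHom W
  id a := SpanHom.mk W (P.id a) (P.id a)
  comp := SpanHom.comp
  id_comp s := by
    obtain ⟨n, f, g, rfl⟩ := s.ind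
    rw [SpanHom.mk_comp_mk_id, P.comp_id]
  comp_id s := by
    obtain ⟨n, f, g, rfl⟩ := s.ind
    rw [SpanHom.mk_id_comp_mk, P.comp_id]
  assoc s t u := by
    obtain ⟨n, f, g, rfl⟩ := s.ind
    obtain ⟨m, h, i, rfl⟩ := t.ind
    obtain ⟨l, j, k, rfl⟩ := u.ind
    obtain ⟨A, p, q, sq⟩ := exists_isPullback g h
    obtain ⟨B, p', q', sq'⟩ := exists_isPullback i j
    obtain ⟨D, r, t, sq2⟩ := exists_isPullback q p'
    have sq3 : IsPullback (P.ar r) (P.ar (P.comp t q')) (P.ar (P.comp q i)) (P.ar j) :=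
      sq2.paste_vert sq'
    have sq4 : IsPullback (P.ar (P.comp r p)) (P.ar t) (P.ar g) (P.ar (P.comp p' h)) :=
      sq2.paste_horiz sq
    rw [SpanHom.mk_comp_mk sq, SpanHom.mk_comp_mk sq', SpanHom.mk_comp_mk sq3,
      SpanHom.mk_comp_mk sq4, P.assoc, P.assoc]

theorem spanCat_comp {a b c : ℕ} (s : SpanHom W a b) (t : SpanHom W b c) :
    (spanCat P W).comp s t = s.comp t := rfl

theorem spanCat_id (a : ℕ) : (spanCat P W).id a = SpanHom.mk W (P.id a) (P.id a) := rfl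

theorem spanCat_eqHom {a b : ℕ} (h : a = b) :
    (spanCat P W).eqHom h = SpanHom.mk W (P.id a) (P.eqHom h) := by
  subst h; rfl

theorem spanCat_eqHom' {a b : ℕ} (h : a = b) :
    (spanCat P W).eqHom h = SpanHom.mk W (P.eqHom h.symm) (P.id b) := by
  subst h; rfl

theorem SpanHom.mk_symm (a b : ℕ) :
    SpanHom.mk W (P.id (a + b)) (P.symm a b) = SpanHom.mk W (P.symm b a) (P.id (b + a)) := by
  exact (SpanHom.eq_of (P.symm b a) (SpanClass.of_isIso _ (P.isIso_symm b a))
    (P.comp_id _) (P.symm_symm b a)).symm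

theorem SpanHom.mk_tensor_unit {n a b : ℕ} (f : P.Hom n a) (g : P.Hom n b) :
    SpanHom.mk W (P.tensor (P.id 0) f)
        (P.comp (P.tensor (P.id 0) g) (P.eqHom (Nat.zero_add b))) =
      SpanHom.mk W (P.comp f (P.eqHom (Nat.zero_add a).symm)) g := by
  refine SpanHom.eq_of (P.eqHom (Nat.zero_add n)) (SpanClass.of_isIso _ (P.isIso_eqHom _)) ?_
    (P.unit_tensor g).symm
  rw [← P.assoc, ← P.unit_tensor, P.assoc, eqHom_comp_eqHom, NatCategory.eqHom_rfl, P.comp_id]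

theorem SpanHom.mk_tensor_assoc {a b c a' b' c' n m l : ℕ} (f : P.Hom n a) (f' : P.Hom n a')
    (g : P.Hom m b) (g' : P.Hom m b') (h : P.Hom l c) (h' : P.Hom l c') :
    SpanHom.mk W (P.tensor (P.tensor f g) h)
        (P.comp (P.tensor (P.tensor f' g') h') (P.eqHom (Nat.add_assoc a' b' c'))) =
      SpanHom.mk W (P.comp (P.tensor f (P.tensor g h)) (P.eqHom (Nat.add_assoc a b c).symm))
        (P.tensor f' (P.tensor g' h')) := by
  refine SpanHom.eq_of (P.eqHom (Nat.add_assoc n m l)) (SpanClass.of_isIso _ (P.isIso_eqHom _)) ?_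
    (P.tensor_assoc f' g' h').symm
  rw [← P.assoc, ← P.tensor_assoc, P.assoc, eqHom_comp_eqHom, NatCategory.eqHom_rfl, P.comp_id]

theorem SpanHom.mk_symm_natural {a b a' b' n m : ℕ} (f : P.Hom n a) (f' : P.Hom n a')
    (g : P.Hom m b) (g' : P.Hom m b') :
    SpanHom.mk W (P.tensor f g) (P.comp (P.tensor f' g') (P.symm a' b')) =
      SpanHom.mk W (P.comp (P.tensor g f) (P.symm b a)) (P.tensor g' f') := by
  refine SpanHom.eq_of (P.symm n m) (SpanClass.of_isIso _ (P.isIso_symm _ _)) ?_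
    (P.symm_natural f' g').symm
  rw [← P.assoc, ← P.symm_natural, P.assoc, P.symm_symm, P.comp_id]

theorem SpanHom.mk_id_comp_mk_id {a b c : ℕ} (f : P.Hom a b) (g : P.Hom b c) :
    (SpanHom.mk W (P.id a) f).comp (SpanHom.mk W (P.id b) g) =
      SpanHom.mk W (P.id a) (P.comp f g) :=
  SpanHom.mk_id_comp_mk _ _ _

theorem SpanHom.mk_id_tensor_mk_id {a b c d : ℕ} (f : P.Hom a b) (g : P.Hom c d) :
    (SpanHom.mk W (P.id a) f).tensor (SpanHom.mk W (P.id c) g) =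
      SpanHom.mk W (P.id (a + c)) (P.tensor f g) := by
  rw [SpanHom.mk_tensor_mk, P.tensor_id]

/-- The prop whose arrows are spans in `P`, modulo the equivalence relation generated by the
arrows of spans that lie in `W`. Composition is by pullback and the monoidal product is that of
`P`, applied to both legs. -/
noncomputable def spanProp : PROP.{v} where
  toNatCategory := spanCat P W
  tensor := SpanHom.tensor
  symm a b := SpanHom.mk W (P.id (a + b)) (P.symm a b)
  tensor_id a b := SpanHom.mk_id_tensor_mk_id P W (P.id a) (P.id b) |>.trans
    (by rw [P.tensor_id]; rfl)
  tensor_comp s t s' t' := by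
    obtain ⟨n, f, g, rfl⟩ := s.ind
    obtain ⟨m, h, i, rfl⟩ := t.ind
    obtain ⟨n', f', g', rfl⟩ := s'.ind
    obtain ⟨m', h', i', rfl⟩ := t'.ind
    obtain ⟨A, p, q, sq⟩ := exists_isPullback g h
    obtain ⟨A', p', q', sq'⟩ := exists_isPullback g' h'
    rw [spanCat_comp, spanCat_comp, spanCat_comp, SpanHom.mk_comp_mk sq, SpanHom.mk_comp_mk sq', SpanHom.mk_tensor_mk, SpanHom.mk_tensor_mk,
      SpanHom.mk_tensor_mk, SpanHom.mk_comp_mk (HasSpans.tensor_isPullback sq sq'),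
      P.tensor_comp, P.tensor_comp]
  tensor_unit s := by
    obtain ⟨n, f, g, rfl⟩ := s.ind
    rw [spanCat_id, SpanHom.mk_tensor_mk, P.tensor_unit, P.tensor_unit]
  unit_tensor {a b} s := by
    obtain ⟨n, f, g, rfl⟩ := s.ind
    rw [spanCat_eqHom, spanCat_eqHom', spanCat_comp, spanCat_comp, spanCat_id, SpanHom.mk_tensor_mk, SpanHom.mk_id_comp_mk, SpanHom.mk_comp_mk_id]
    exact SpanHom.mk_tensor_unit P W f g
  tensor_assoc s t u := by
    obtain ⟨n, f, g, rfl⟩ := s.ind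
    obtain ⟨m, h, i, rfl⟩ := t.ind
    obtain ⟨l, j, k, rfl⟩ := u.ind
    rw [spanCat_eqHom, spanCat_eqHom', spanCat_comp, spanCat_comp, SpanHom.mk_tensor_mk, SpanHom.mk_tensor_mk, SpanHom.mk_tensor_mk, SpanHom.mk_tensor_mk,
      SpanHom.mk_id_comp_mk, SpanHom.mk_comp_mk_id]
    exact SpanHom.mk_tensor_assoc P W f g h i j k
  symm_natural s t := by
    obtain ⟨n, f, g, rfl⟩ := s.ind
    obtain ⟨m, h, i, rfl⟩ := t.ind
    rw [spanCat_comp, spanCat_comp, SpanHom.mk_tensor_mk, SpanHom.mk_tensor_mk, SpanHom.mk_id_comp_mk,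
      SpanHom.mk_symm, SpanHom.mk_comp_mk_id]
    exact SpanHom.mk_symm_natural P W f g h i
  symm_symm a b := (SpanHom.mk_id_comp_mk_id P W _ _).trans (by rw [P.symm_symm]; rfl)
  hexagon a b c := by
    simp only [spanCat_eqHom, spanCat_comp, spanCat_id, SpanHom.mk_id_comp_mk_id, SpanHom.mk_id_tensor_mk_id]
    rw [P.hexagon]

/-- The morphism of props sending `f` to the span `a ⟵ a ⟶ b` with legs the identity and `f`. -/
noncomputable def spanOfHom : P ⟶ spanProp P W where
  map f := SpanHom.mk W (P.id _) f
  map_id _ := rfl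
  map_comp f g := (SpanHom.mk_id_comp_mk_id P W f g).symm
  map_tensor f g := (SpanHom.mk_id_tensor_mk_id P W f g).symm
  map_symm _ _ := rfl

/-- The morphism of props sending `g`, seen as an arrow `a ⟶ b` of the opposite prop, to the span
`a ⟵ b ⟶ b` with legs `g` and the identity. -/
noncomputable def spanOfOp : P.op ⟶ spanProp P W where
  map g := SpanHom.mk W g (P.id _)
  map_id _ := rfl
  map_comp {a b c} f g := (SpanHom.mk_comp_mk_id (P := P) (W := W) (a := a) (b := b) (m := c)
    f g (P.id c)).symm
  map_tensor {a b c d} f g := by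
    refine Eq.trans ?_ (SpanHom.mk_tensor_mk (W := W) f (P.id b) g (P.id d)).symm
    rw [P.tensor_id]
    rfl
  map_symm a b := (SpanHom.mk_symm P W a b).symm

theorem app_spanOfHom {a b : ℕ} (f : P.Hom a b) :
    app (spanOfHom P W) f = SpanHom.mk W (P.id a) f := rfl

theorem app_spanOfOp {a b : ℕ} (f : P.Hom b a) :
    app (spanOfOp P W) (a := a) (b := b) f = SpanHom.mk W f (P.id b) := rfl

/-- Every span is the composite of a backward arrow and a forward arrow. -/
theorem spanOfOp_comp_spanOfHom {a b n : ℕ} (f : P.Hom n a) (g : P.Hom n b) :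
    (spanProp P W).comp (app (spanOfOp P W) (a := a) (b := n) f) (app (spanOfHom P W) g) =
      SpanHom.mk W f g := by
  rw [app_spanOfOp, app_spanOfHom]
  exact (SpanHom.mk_comp_mk_id (W := W) f (P.id n) g).trans (by rw [P.id_comp])

theorem spanOfHom_comp_spanOfOp {a b c n : ℕ} {p : P.Hom n a} {q : P.Hom n b} {f : P.Hom a c}
    {g : P.Hom b c} (sq : IsPullback (P.ar p) (P.ar q) (P.ar f) (P.ar g)) :
    (spanProp P W).comp (app (spanOfHom P W) f) (app (spanOfOp P W) (a := c) (b := b) g) =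
      SpanHom.mk W p q := by
  rw [app_spanOfOp, app_spanOfHom]
  exact (SpanHom.mk_comp_mk (W := W) sq).trans (by rw [P.comp_id, P.comp_id])

end SpanProp


/-! ### Spans, cospans, relations and corelations in an abelian prop -/

section Abelian

theorem isPullback_biprod_map {A : Type*} [Category A] [Abelian A]
    {a b c d a' b' c' d' : A} {p : a ⟶ b} {q : a ⟶ c} {f : b ⟶ d} {g : c ⟶ d}
    {p' : a' ⟶ b'} {q' : a' ⟶ c'} {f' : b' ⟶ d'} {g' : c' ⟶ d'}
    (sq : IsPullback p q f g) (sq' : IsPullback p' q' f' g') :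
    IsPullback (biprod.map p p') (biprod.map q q') (biprod.map f f') (biprod.map g g') := by
  refine ⟨⟨by ext <;> simp [sq.w, sq'.w]⟩, ⟨PullbackCone.IsLimit.mk _ (fun s =>
    biprod.lift
      (sq.lift (s.fst ≫ biprod.fst) (s.snd ≫ biprod.fst)
        (by simpa using congrArg (fun t => t ≫ biprod.fst) s.condition))
      (sq'.lift (s.fst ≫ biprod.snd) (s.snd ≫ biprod.snd)
        (by simpa using congrArg (fun t => t ≫ biprod.snd) s.condition))) ?_ ?_ ?_⟩⟩
  · intro s; ext <;> simp
  · intro s; ext <;> simp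
  · intro s m h h'
    ext
    · apply sq.hom_ext <;> simp [← h, ← h']
    · apply sq'.hom_ext <;> simp [← h, ← h']

/-- In an abelian category, the canonical arrow from the pushout of the pullback of a cospan is a
monomorphism. -/
theorem mono_of_isPullback_isPushout {A : Type*} [Category A] [Abelian A] {k x y q a : A}
    {p : k ⟶ x} {p' : k ⟶ y} {f : x ⟶ a} {g : y ⟶ a} {i : x ⟶ q} {j : y ⟶ q}
    (sq : IsPullback p p' f g) (sq' : IsPushout p p' i j) (m : q ⟶ a) (hi : i ≫ m = f)
    (hj : j ≫ m = g) : Mono m := by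
  have hepi : Epi (biprod.desc i j) := by
    refine ⟨fun u v h => ?_⟩
    apply sq'.hom_ext
    · simpa using congrArg (fun t => biprod.inl ≫ t) h
    · simpa using congrArg (fun t => biprod.inr ≫ t) h
  refine Preadditive.mono_of_cancel_zero _ fun {t} u hu => ?_
  obtain ⟨t', e, w, he, hw⟩ : ∃ (t' : A) (e : t' ⟶ t) (w : t' ⟶ x ⊞ y), Epi e ∧
      e ≫ u = w ≫ biprod.desc i j :=
    ⟨_, pullback.fst u (biprod.desc i j), pullback.snd u (biprod.desc i j), inferInstance,
      pullback.condition⟩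
  rw [← cancel_epi e, comp_zero, hw]
  have h0 : (w ≫ biprod.fst) ≫ f = (-(w ≫ biprod.snd)) ≫ g := by
    have h1 : w ≫ biprod.desc i j ≫ m = 0 := by
      rw [← Category.assoc, ← hw, Category.assoc, hu, comp_zero]
    rw [biprod.desc_eq, Preadditive.add_comp, Category.assoc, Category.assoc, hi, hj,
      Preadditive.comp_add] at h1
    rw [Preadditive.neg_comp, Category.assoc, Category.assoc]
    exact eq_neg_of_add_eq_zero_left h1
  have h2 := sq.lift_fst _ _ h0
  have h3 := sq.lift_snd _ _ h0
  rw [biprod.desc_eq, Preadditive.comp_add, ← Category.assoc, ← h2, Category.assoc, sq'.w,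
    ← Category.assoc, h3, Preadditive.neg_comp, Category.assoc, neg_add_cancel]

theorem isPushout_epi_comp {A : Type*} [Category A] {n' n a b q : A} (e : n' ⟶ n) [Epi e]
    {f : n ⟶ a} {g : n ⟶ b} {i : a ⟶ q} {j : b ⟶ q} (sq : IsPushout f g i j) :
    IsPushout (e ≫ f) (e ≫ g) i j := by
  have hc (s : PushoutCocone (e ≫ f) (e ≫ g)) : f ≫ s.inl = g ≫ s.inr := by
    rw [← cancel_epi e, ← Category.assoc, ← Category.assoc]; exact s.condition
  refine ⟨⟨by rw [Category.assoc, sq.w, Category.assoc]⟩, ⟨PushoutCocone.IsColimit.mk _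
    (fun s => sq.desc s.inl s.inr (hc s)) (fun s => sq.inl_desc _ _ _)
    (fun s => sq.inr_desc _ _ _) fun s m h h' => ?_⟩⟩
  apply sq.hom_ext <;> simp [h, h']

variable (P : PROP.{v})

theorem isPullback_op {a b c n : ℕ} {f : P.Hom n a} {g : P.Hom n b} {i : P.Hom a c}
    {j : P.Hom b c} (sq : IsPushout (P.ar f) (P.ar g) (P.ar i) (P.ar j)) :
    IsPullback (P.op.ar (a := c) (b := a) i) (P.op.ar (a := c) (b := b) j)
      (P.op.ar (a := a) (b := n) f) (P.op.ar (a := b) (b := n) g) :=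
  IsPullback.of_map P.opFunctor sq.w sq.op.flip

instance [h : P.IsAbelian] : P.HasSpans := by
  obtain ⟨_, φ, hφ⟩ := h
  have hφ' {a b c d : ℕ} (f : P.Hom a b) (g : P.Hom c d) :
      biprod.map (P.ar f) (P.ar g) ≫ (φ b d).symm.hom =
        (φ a c).symm.hom ≫ P.ar (P.tensor f g) := by
    rw [Iso.symm_hom, Iso.symm_hom, Iso.comp_inv_eq, Category.assoc, hφ, Iso.inv_hom_id_assoc]
  exact ⟨inferInstance, fun sq sq' => (isPullback_biprod_map sq sq').of_iso
    (φ _ _).symm (φ _ _).symm (φ _ _).symm (φ _ _).symm (hφ' _ _) (hφ' _ _) (hφ' _ _) (hφ' _ _)⟩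

instance [h : P.IsAbelian] : HasPushouts P.Ob := by
  obtain ⟨_, -⟩ := h
  infer_instance

instance [h : P.IsAbelian] : P.SpanClass (MorphismProperty.isomorphisms P.Ob) := by
  obtain ⟨_, φ, hφ⟩ := h
  refine ⟨fun f hf => hf, inferInstance, fun {a b c d} f g hf hg => ?_⟩
  have : IsIso (P.ar f) := hf
  have : IsIso (P.ar g) := hg
  have h1 : P.ar (P.tensor f g) =
      (φ a c).hom ≫ (biprod.mapIso (asIso (P.ar f)) (asIso (P.ar g))).hom ≫ (φ b d).inv := by
    rw [← Category.assoc, Iso.eq_comp_inv, hφ]; rfl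
  rw [h1]
  exact inferInstanceAs (IsIso (_ ≫ _ ≫ _))

instance [h : P.IsAbelian] : P.SpanClass (MorphismProperty.epimorphisms P.Ob) := by
  obtain ⟨_, φ, hφ⟩ := h
  refine ⟨fun f hf => inferInstanceAs (Epi f), inferInstance, fun {a b c d} f g hf hg => ?_⟩
  have : Epi (P.ar f) := hf
  have : Epi (P.ar g) := hg
  have h1 : P.ar (P.tensor f g) = (φ a c).hom ≫ biprod.map (P.ar f) (P.ar g) ≫ (φ b d).inv := by
    rw [← Category.assoc, Iso.eq_comp_inv, hφ]
  rw [h1]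
  exact inferInstanceAs (Epi (_ ≫ _ ≫ _))

variable [P.IsAbelian]

/-- The prop of spans: an arrow `a ⟶ b` is an isomorphism class of spans `a ⟵ n ⟶ b` in `P`. -/
noncomputable def Span : PROP.{v} := spanProp P (MorphismProperty.isomorphisms P.Ob)

/-- The prop of relations, for the epi-mono factorisation system: an arrow `a ⟶ b` is an
equivalence class of spans `a ⟵ n ⟶ b` in `P`, for the equivalence relation that identifies two
spans whenever there is an epimorphism between their apices that commutes with the legs. -/
noncomputable def Rel : PROP.{v} := spanProp P (MorphismProperty.epimorphisms P.Ob)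

/-- The prop of cospans: a cospan `a ⟶ n ⟵ b` in `P` is a span in the opposite prop, and a
pushout in `P` is a pullback in the opposite prop. -/
noncomputable def Cospan : PROP.{v} := Span P.op

/-- The prop of corelations, for the epi-mono factorisation system: an arrow `a ⟶ b` is an
equivalence class of cospans `a ⟶ n ⟵ b` in `P`, for the equivalence relation that identifies two
cospans whenever there is a monomorphism between their apices (an epimorphism of the opposite
prop) that commutes with the legs. -/
noncomputable def Corel : PROP.{v} := Rel P.op

variable {P}

/-- The isomorphism class of the span `a ⟵ n ⟶ b` with legs `f` and `g`. -/
def spanMk {a b n : ℕ} (f : P.Hom n a) (g : P.Hom n b) : P.Span.Hom a b :=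
  SpanHom.mk (MorphismProperty.isomorphisms P.Ob) f g

/-- The relation represented by the span `a ⟵ n ⟶ b` with legs `f` and `g`. -/
def relMk {a b n : ℕ} (f : P.Hom n a) (g : P.Hom n b) : P.Rel.Hom a b :=
  SpanHom.mk (MorphismProperty.epimorphisms P.Ob) f g

/-- The isomorphism class of the cospan `a ⟶ n ⟵ b` with legs `f` and `g`. -/
def cospanMk {a b n : ℕ} (f : P.Hom a n) (g : P.Hom b n) : P.Cospan.Hom a b :=
  spanMk (P := P.op) f g

/-- The corelation represented by the cospan `a ⟶ n ⟵ b` with legs `f` and `g`. -/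
def corelMk {a b n : ℕ} (f : P.Hom a n) (g : P.Hom b n) : P.Corel.Hom a b :=
  relMk (P := P.op) f g

variable (P)

/-- The morphism sending `f : a ⟶ b` to the span `a ⟵ a ⟶ b` with legs the identity and `f`. -/
noncomputable def homToSpan : P ⟶ P.Span := spanOfHom P _

/-- The morphism sending `g : b ⟶ a`, as an arrow `a ⟶ b` of the opposite prop, to the span
`a ⟵ b ⟶ b` with legs `g` and the identity. -/
noncomputable def opToSpan : P.op ⟶ P.Span := spanOfOp P _

/-- The morphism sending `f : a ⟶ b` to the cospan `a ⟶ b ⟵ b` with legs `f` and the identity. -/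
noncomputable def homToCospan : P ⟶ P.Cospan := opToSpan P.op

/-- The morphism sending `g : b ⟶ a`, as an arrow `a ⟶ b` of the opposite prop, to the cospan
`a ⟶ a ⟵ b` with legs the identity and `g`. -/
noncomputable def opToCospan : P.op ⟶ P.Cospan := homToSpan P.op

theorem app_homToSpan {a b : ℕ} (f : P.Hom a b) : app P.homToSpan f = spanMk (P.id a) f := rfl
theorem app_opToSpan {a b : ℕ} (g : P.Hom b a) :
    app P.opToSpan (a := a) (b := b) g = spanMk g (P.id b) := rfl
theorem app_homToCospan {a b : ℕ} (f : P.Hom a b) :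
    app P.homToCospan f = cospanMk f (P.id b) := rfl
theorem app_opToCospan {a b : ℕ} (g : P.Hom b a) :
    app P.opToCospan (a := a) (b := b) g = cospanMk (P.id a) g := rfl

variable {P} in
/-- An isomorphism class of spans determines a relation. -/
def spanToRelMap {a b : ℕ} (s : P.Span.Hom a b) : P.Rel.Hom a b :=
  Quot.lift (fun t : RawSpan P a b => relMk t.left t.right)
    (by
      rintro ⟨n, f, g⟩ ⟨m, h, k⟩ ⟨e, he, hf, hg⟩
      have he : IsIso (P.ar e) := he
      exact SpanHom.eq_of e (inferInstanceAs (Epi (P.ar e))) hf hg) s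

/-- The morphism sending the isomorphism class of a span to the relation that it represents. -/
noncomputable def spanToRel : P.Span ⟶ P.Rel where
  map := spanToRelMap
  map_id _ := rfl
  map_comp s t := by
    obtain ⟨n, f, g, rfl⟩ := SpanHom.ind s
    obtain ⟨m, h, k, rfl⟩ := SpanHom.ind t
    obtain ⟨l, p, q, sq⟩ := exists_isPullback g h
    exact (congrArg spanToRelMap (SpanHom.mk_comp_mk sq)).trans (SpanHom.mk_comp_mk sq).symm
  map_tensor s t := by
    obtain ⟨n, f, g, rfl⟩ := SpanHom.ind s
    obtain ⟨m, h, k, rfl⟩ := SpanHom.ind t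
    rfl
  map_symm _ _ := rfl

/-- The morphism `Γ` sending the isomorphism class of a cospan to the corelation that it
represents. -/
noncomputable def cospanToCorel : P.Cospan ⟶ P.Corel := spanToRel P.op

theorem app_spanToRel {a b n : ℕ} (f : P.Hom n a) (g : P.Hom n b) :
    app P.spanToRel (spanMk f g) = relMk f g := rfl
theorem app_cospanToCorel {a b n : ℕ} (f : P.Hom a n) (g : P.Hom b n) :
    app P.cospanToCorel (cospanMk f g) = corelMk f g := rfl

variable {P}

theorem corelMk_eq {a b n m : ℕ} {f : P.Hom a n} {g : P.Hom b n} {f' : P.Hom a m} {g' : P.Hom b m}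
    (e : P.Hom n m) (he : Mono (P.ar e)) (hf : P.comp f e = f') (hg : P.comp g e = g') :
    corelMk f g = corelMk f' g' := by
  refine (SpanHom.eq_of (P := P.op) (W := MorphismProperty.epimorphisms P.op.Ob) e ?_ hf hg).symm
  refine ⟨fun {x} u w h => ?_⟩
  let u' : P.ob x ⟶ P.ob n := u
  let w' : P.ob x ⟶ P.ob n := w
  change u' ≫ P.ar e = w' ≫ P.ar e at h
  exact (cancel_mono (P.ar e)).1 h

theorem exists_isPushout {a b n : ℕ} (f : P.Hom n a) (g : P.Hom n b) :
    ∃ (m : ℕ) (i : P.Hom a m) (j : P.Hom b m),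
      IsPushout (P.ar f) (P.ar g) (P.ar i) (P.ar j) :=
  ⟨_, _, _, IsPushout.of_hasPushout (P.ar f) (P.ar g)⟩

/-- The corelation represented by the pushout of a span. -/
noncomputable def pushoutCorel {a b : ℕ} (s : RawSpan P a b) : P.Corel.Hom a b :=
  corelMk (n := (pushout (P.ar s.left) (P.ar s.right) : P.Ob))
    (pushout.inl (P.ar s.left) (P.ar s.right)) (pushout.inr (P.ar s.left) (P.ar s.right))

theorem pushoutCorel_eq {a b n m : ℕ} {f : P.Hom n a} {g : P.Hom n b} {i : P.Hom a m}
    {j : P.Hom b m} (sq : IsPushout (P.ar f) (P.ar g) (P.ar i) (P.ar j)) :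
    pushoutCorel ⟨n, f, g⟩ = corelMk i j :=
  (corelMk_eq sq.isoPushout.hom (inferInstanceAs (Mono sq.isoPushout.hom))
    sq.inl_isoPushout_hom sq.inr_isoPushout_hom).symm

/-- The corelation represented by the pushout of an isomorphism class of spans. -/
noncomputable def spanToCorelMap {a b : ℕ} (s : P.Span.Hom a b) : P.Corel.Hom a b :=
  Quot.lift pushoutCorel
    (by
      rintro ⟨n, f, g⟩ ⟨m, h, k⟩ ⟨e, he, hf, hg⟩
      dsimp only at e he hf hg
      subst hf hg
      have he : IsIso (P.ar e) := he
      obtain ⟨q, i, j, sq⟩ := exists_isPushout h k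
      have sq' : IsPushout (P.ar (P.comp e h)) (P.ar (P.comp e k)) (P.ar i) (P.ar j) :=
        isPushout_epi_comp (P.ar e) sq
      rw [pushoutCorel_eq sq, pushoutCorel_eq sq']) s

theorem spanToCorelMap_mk {a b n m : ℕ} {f : P.Hom n a} {g : P.Hom n b} {i : P.Hom a m}
    {j : P.Hom b m} (sq : IsPushout (P.ar f) (P.ar g) (P.ar i) (P.ar j)) :
    spanToCorelMap (spanMk f g) = corelMk i j :=
  pushoutCorel_eq sq

/-- The inclusion of `P` into corelations. -/
noncomputable def homToCorel (P : PROP.{v}) [P.IsAbelian] : P ⟶ P.Corel :=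
  P.homToCospan ≫ P.cospanToCorel

/-- The inclusion of the opposite of `P` into corelations. -/
noncomputable def opToCorel (P : PROP.{v}) [P.IsAbelian] : P.op ⟶ P.Corel :=
  P.opToCospan ≫ P.cospanToCorel

theorem spanToCorelMap_eq {a b n : ℕ} (f : P.Hom n a) (g : P.Hom n b) :
    spanToCorelMap (spanMk f g) =
      P.Corel.comp (app P.opToCorel (a := a) (b := n) f) (app P.homToCorel g) := by
  obtain ⟨m, i, j, sq⟩ := exists_isPushout f g
  rw [spanToCorelMap_mk sq]
  exact (spanOfHom_comp_spanOfOp (P := P.op) (W := MorphismProperty.epimorphisms P.op.Ob)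
    (isPullback_op P sq)).symm

theorem homToCorel_comp_opToCorel {a b c : ℕ} (f : P.Hom a c) (g : P.Hom b c) :
    P.Corel.comp (app P.homToCorel f) (app P.opToCorel (a := c) (b := b) g) = corelMk f g :=
  spanOfOp_comp_spanOfHom (P := P.op) (W := MorphismProperty.epimorphisms P.op.Ob) f g

theorem spanToCorelMap_isPullback {a b c n : ℕ} {p : P.Hom n a} {q : P.Hom n b} {f : P.Hom a c}
    {g : P.Hom b c} (sq : IsPullback (P.ar p) (P.ar q) (P.ar f) (P.ar g)) :
    spanToCorelMap (spanMk p q) = corelMk f g := by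
  obtain ⟨m, i, j, sq'⟩ := exists_isPushout p q
  rw [spanToCorelMap_mk sq']
  obtain ⟨_, -⟩ := IsAbelian.exists_biproduct (P := P)
  exact corelMk_eq (sq'.desc _ _ sq.w)
    (mono_of_isPullback_isPushout sq sq' _ (sq'.inl_desc _ _ sq.w) (sq'.inr_desc _ _ sq.w))
    (sq'.inl_desc _ _ sq.w) (sq'.inr_desc _ _ sq.w)

variable (P) in
/-- The morphism `Π` sending the isomorphism class of a span to the corelation represented by its
pushout. -/
noncomputable def spanToCorel : P.Span ⟶ P.Corel where
  map := spanToCorelMap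
  map_id a := spanToCorelMap_mk (IsPushout.id_horiz (𝟙 (P.ob a)))
  map_comp {a b c} s t := by
    obtain ⟨n, f, g, rfl⟩ := SpanHom.ind s
    obtain ⟨m, h, k, rfl⟩ := SpanHom.ind t
    obtain ⟨l, p, q, sq⟩ := exists_isPullback g h
    have h1 : P.Span.comp (spanMk f g) (spanMk h k) = spanMk (P.comp p f) (P.comp q k) :=
      SpanHom.mk_comp_mk sq
    have h2 : app P.opToCorel (a := a) (b := l) (P.comp p f) =
        P.Corel.comp (app P.opToCorel (a := a) (b := n) f)
          (app P.opToCorel (a := n) (b := l) p) := app_comp P.opToCorel _ _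
    have h3 := (spanToCorelMap_eq p q).symm.trans
      ((spanToCorelMap_isPullback sq).trans (homToCorel_comp_opToCorel g h).symm)
    change spanToCorelMap (P.Span.comp (spanMk f g) (spanMk h k)) =
      P.Corel.comp (spanToCorelMap (spanMk f g)) (spanToCorelMap (spanMk h k))
    rw [h1, spanToCorelMap_eq, spanToCorelMap_eq, spanToCorelMap_eq, h2, app_comp, P.Corel.assoc,
      P.Corel.assoc, ← P.Corel.assoc (app P.opToCorel p), h3, P.Corel.assoc]
  map_tensor {a b c d} s t := by
    obtain ⟨n, f, g, rfl⟩ := SpanHom.ind s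
    obtain ⟨m, h, k, rfl⟩ := SpanHom.ind t
    have h1 : app P.opToCorel (a := a + c) (b := n + m) (P.tensor f h) =
        P.Corel.tensor (app P.opToCorel (a := a) (b := n) f)
          (app P.opToCorel (a := c) (b := m) h) := app_tensor P.opToCorel _ _
    change spanToCorelMap (spanMk (P.tensor f h) (P.tensor g k)) =
      P.Corel.tensor (spanToCorelMap (spanMk f g)) (spanToCorelMap (spanMk h k))
    rw [spanToCorelMap_eq, spanToCorelMap_eq, spanToCorelMap_eq, h1, app_tensor,
      P.Corel.tensor_comp]
  map_symm a b := by
    change spanToCorelMap (spanMk (P.id _) (P.symm a b)) = _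
    have h1 : app P.opToCorel (a := a + b) (b := a + b) (P.id _) = P.Corel.id _ :=
      app_id P.opToCorel _
    rw [spanToCorelMap_eq, h1, app_symm, P.Corel.id_comp]

variable (P)

/-- The morphism sending the isomorphism class of a cospan to the relation represented by its
pullback, that is, the morphism `spanToCorel` of the opposite prop. -/
noncomputable def cospanToRel : P.Cospan ⟶ P.Rel := spanToCorel P.op

variable {P}

theorem app_spanToCorel {a b n m : ℕ} {f : P.Hom n a} {g : P.Hom n b} {i : P.Hom a m}
    {j : P.Hom b m} (sq : IsPushout (P.ar f) (P.ar g) (P.ar i) (P.ar j)) :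
    app P.spanToCorel (spanMk f g) = corelMk i j :=
  spanToCorelMap_mk sq

theorem isPushout_op {a b c n : ℕ} {p : P.Hom n a} {q : P.Hom n b} {f : P.Hom a c}
    {g : P.Hom b c} (sq : IsPullback (P.ar p) (P.ar q) (P.ar f) (P.ar g)) :
    IsPushout (P.op.ar (a := c) (b := a) f) (P.op.ar (a := c) (b := b) g)
      (P.op.ar (a := a) (b := n) p) (P.op.ar (a := b) (b := n) q) :=
  IsPushout.of_map P.opFunctor sq.w sq.op.flip

theorem app_cospanToRel {a b c n : ℕ} {p : P.Hom n a} {q : P.Hom n b} {f : P.Hom a c}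
    {g : P.Hom b c} (sq : IsPullback (P.ar p) (P.ar q) (P.ar f) (P.ar g)) :
    app P.cospanToRel (cospanMk f g) = relMk p q :=
  spanToCorelMap_mk (P := P.op) (isPushout_op sq)

end Abelian

end PROP

/-!
Every span is a backward arrow `f°` followed by a forward arrow `g`, and the composition rules
`f ; g° = p° ; q`, one for each pullback square, reduce a composite of such spans to one of the same
shape. Hence the classes of spans modulo `W` are presented by the arrows of `P` and of its opposite,
subject to these rules and to `e° ; e = 1` for `e` in `W`.

Read in the opposite prop, this says that a morphism out of `Corel P` amounts to a morphism out of
`Cospan P` for which `m ; m° = 1` whenever `m` is a monomorphism. In `Span P` this is the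
composition rule of the kernel pair of `m`, so it holds in every prop that receives compatible
morphisms from `Span P` and `Cospan P`: this is the universal property of the pushout. The morphisms
from `Span P` and `Cospan P` to `Rel P` are the dual pair, and the comparison morphisms that they
induce in both directions are mutually inverse since they fix the generators.
-/

namespace PROP

theorem coprod_desc_comp_eq_iff {A : Type*} [Category A] {p q x y z : A} [HasBinaryCoproduct p q]
    {f : p ⟶ x} {g : q ⟶ x} {f' : p ⟶ y} {g' : q ⟶ y} {u : x ⟶ z} {w : y ⟶ z} :
    coprod.desc f g ≫ u = coprod.desc f' g' ≫ w ↔ f ≫ u = f' ≫ w ∧ g ≫ u = g' ≫ w := by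
  simp only [coprod.hom_ext_iff, coprod.inl_desc_assoc, coprod.inr_desc_assoc]

theorem mono_of_epi_op {P : PROP.{v}} {a b : ℕ} (f : P.Hom a b)
    (hf : Epi (P.op.ar (a := b) (b := a) f)) : Mono (P.ar f) :=
  ⟨fun {x} u w h => hf.left_cancellation (Z := P.op.ob x) u w h⟩

section SpanPresentation

variable {P X Y : PROP.{v}}

/-- The value at `f : a ⟶ b` of a morphism out of the opposite prop, as an arrow `b ⟶ a`. The
arrows of `P.op` unfold to those of `P`, so `app` alone would leave the direction of `f` to be
specified at every use. -/
def appOp (G : P.op ⟶ X) {a b : ℕ} (f : P.Hom a b) : X.Hom b a := app G (a := b) (b := a) f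

theorem appOp_id (G : P.op ⟶ X) (a : ℕ) : appOp G (P.id a) = X.id a := app_id G a

theorem appOp_comp (G : P.op ⟶ X) {a b c : ℕ} (f : P.Hom a b) (g : P.Hom b c) :
    appOp G (P.comp f g) = X.comp (appOp G g) (appOp G f) :=
  app_comp G (a := c) (b := b) (c := a) g f

theorem appOp_tensor (G : P.op ⟶ X) {a b c d : ℕ} (f : P.Hom a b) (g : P.Hom c d) :
    appOp G (P.tensor f g) = X.tensor (appOp G f) (appOp G g) :=
  app_tensor G (a := b) (b := a) (c := d) (d := c) f g

theorem comp_appOp (G : P.op ⟶ X) (K : X ⟶ Y) {a b : ℕ} (f : P.Hom a b) :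
    appOp (G ≫ K) f = app K (appOp G f) := rfl

/-- The relations that present the spans in `P` modulo `W`, for the images under `F` of the forward
arrows and under `G` of the backward arrows: the composition rule given by each pullback square, and
the triviality of the spans with two equal legs in `W`. -/
structure SpanRelations (W : MorphismProperty P.Ob) (F : P ⟶ X) (G : P.op ⟶ X) : Prop where
  comp_eq_of_isPullback : ∀ {a b c n : ℕ} {p : P.Hom n a} {q : P.Hom n b} {f : P.Hom a c}
    {g : P.Hom b c}, IsPullback (P.ar p) (P.ar q) (P.ar f) (P.ar g) →
      X.comp (app F f) (appOp G g) = X.comp (appOp G p) (app F q)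
  comp_eq_id_of_prop : ∀ {a b : ℕ} (e : P.Hom a b), W (P.ar e) →
    X.comp (appOp G e) (app F e) = X.id b

namespace SpanRelations

variable {W : MorphismProperty P.Ob} {F : P ⟶ X} {G : P.op ⟶ X}

theorem postcomp (h : SpanRelations W F G) (K : X ⟶ Y) : SpanRelations W (F ≫ K) (G ≫ K) where
  comp_eq_of_isPullback sq := by
    simpa only [app_comp, comp_app, comp_appOp] using
      congrArg (app K) (h.comp_eq_of_isPullback sq)
  comp_eq_id_of_prop e he := by
    simpa only [app_comp, app_id, comp_app, comp_appOp] using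
      congrArg (app K) (h.comp_eq_id_of_prop e he)

theorem comp_eq_id_of_mono (h : SpanRelations W F G) {a b : ℕ} (m : P.Hom a b) [Mono (P.ar m)] :
    X.comp (app F m) (appOp G m) = X.id a := by
  have kernelPair : IsPullback (P.ar (P.id a)) (P.ar (P.id a)) (P.ar m) (P.ar m) :=
    IsKernelPair.id_of_mono (P.ar m)
  rw [h.comp_eq_of_isPullback kernelPair, appOp_id, app_id, X.id_comp]

theorem appOp_comp_app_eq_of_prop (h : SpanRelations W F G) {a b n m : ℕ} {e : P.Hom n m}
    (he : W (P.ar e)) (f : P.Hom m a) (g : P.Hom m b) :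
    X.comp (appOp G (P.comp e f)) (app F (P.comp e g)) = X.comp (appOp G f) (app F g) := by
  rw [appOp_comp, app_comp, X.assoc, ← X.assoc (appOp G e), h.comp_eq_id_of_prop e he, X.id_comp]

theorem appOp_comp_app_comp_of_isPullback (h : SpanRelations W F G) {a b c n m k : ℕ}
    {g : P.Hom n b} {g' : P.Hom m b} {p : P.Hom k n} {q : P.Hom k m}
    (sq : IsPullback (P.ar p) (P.ar q) (P.ar g) (P.ar g')) (f : P.Hom n a) (f' : P.Hom m c) :
    X.comp (X.comp (appOp G f) (app F g)) (X.comp (appOp G g') (app F f')) =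
      X.comp (appOp G (P.comp p f)) (app F (P.comp q f')) := by
  rw [X.assoc, ← X.assoc (app F g), h.comp_eq_of_isPullback sq, appOp_comp, app_comp, X.assoc,
    X.assoc]

variable [P.HasSpans] [P.SpanClass W]

/-- The morphism out of the spans modulo `W` that is induced by images of the generators, sending
the span with legs `f` and `g` to `f° ; g`. -/
noncomputable def desc (h : SpanRelations W F G) : spanProp P W ⟶ X where
  map := Quot.lift (fun s => X.comp (appOp G s.left) (app F s.right)) (by
    rintro s t ⟨e, he, hleft, hright⟩
    rw [← hleft, ← hright]
    exact h.appOp_comp_app_eq_of_prop he t.left t.right)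
  map_id a := show X.comp (appOp G (P.id a)) (app F (P.id a)) = X.id a by
    rw [appOp_id, app_id, X.id_comp]
  map_comp s t := by
    obtain ⟨n, f, g, rfl⟩ := s.ind
    obtain ⟨m, g', f', rfl⟩ := t.ind
    obtain ⟨k, p, q, sq⟩ := exists_isPullback g g'
    exact (congrArg _ (SpanHom.mk_comp_mk sq)).trans
      (h.appOp_comp_app_comp_of_isPullback sq f f').symm
  map_tensor s t := by
    obtain ⟨n, f, g, rfl⟩ := s.ind
    obtain ⟨m, f', g', rfl⟩ := t.ind
    change X.comp (appOp G (P.tensor f f')) (app F (P.tensor g g')) =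
      X.tensor (X.comp (appOp G f) (app F g)) (X.comp (appOp G f') (app F g'))
    rw [appOp_tensor, app_tensor, X.tensor_comp]
  map_symm a b := show X.comp (appOp G (P.id (a + b))) (app F (P.symm a b)) = X.symm a b by
    rw [appOp_id, app_symm, X.id_comp]

theorem spanOfHom_desc (h : SpanRelations W F G) : spanOfHom P W ≫ h.desc = F :=
  hom_ext fun {a b} f => show X.comp (appOp G (P.id a)) (app F f) = app F f by
    rw [appOp_id, X.id_comp]

theorem spanOfOp_desc (h : SpanRelations W F G) : spanOfOp P W ≫ h.desc = G :=
  hom_ext fun {a b} g => show X.comp (appOp G (a := b) (b := a) g) (app F (P.id b)) = app G g by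
    rw [app_id, X.comp_id]; rfl

end SpanRelations

variable (W : MorphismProperty P.Ob) [P.HasSpans] [P.SpanClass W]

theorem spanRelations_spanOfHom_spanOfOp : SpanRelations W (spanOfHom P W) (spanOfOp P W) where
  comp_eq_of_isPullback {_ _ _ _ p q _ _} sq :=
    (spanOfHom_comp_spanOfOp P W sq).trans (spanOfOp_comp_spanOfHom P W p q).symm
  comp_eq_id_of_prop e he := (spanOfOp_comp_spanOfHom P W e e).trans
    (SpanHom.eq_of e he (P.comp_id e) (P.comp_id e))

variable {W}

theorem spanProp_hom_ext {F G : spanProp P W ⟶ X} (hom : spanOfHom P W ≫ F = spanOfHom P W ≫ G)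
    (op : spanOfOp P W ≫ F = spanOfOp P W ≫ G) : F = G := by
  refine hom_ext fun {a b} s => ?_
  obtain ⟨n, f, g, rfl⟩ := SpanHom.ind s
  have hf : app F (appOp (spanOfOp P W) f) = app G (appOp (spanOfOp P W) f) :=
    congrArg (fun K => appOp K f) op
  have hg : app F (app (spanOfHom P W) g) = app G (app (spanOfHom P W) g) :=
    congrArg (fun K => app K g) hom
  have factorization : SpanHom.mk W f g =
      (spanProp P W).comp (appOp (spanOfOp P W) f) (app (spanOfHom P W) g) :=
    (spanOfOp_comp_spanOfHom P W f g).symm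
  rw [factorization, app_comp, app_comp, hf, hg]

end SpanPresentation

section CorelPushout

variable {P X : PROP.{v}} [P.IsAbelian]

theorem homToSpan_comp_spanToCorel :
    P.homToSpan ≫ P.spanToCorel = P.homToCospan ≫ P.cospanToCorel :=
  hom_ext fun {a b} f => app_spanToCorel (a := a) (b := b) (f := P.id a) (g := f) (i := f)
    (j := P.id b) (IsPushout.id_horiz (P.ar f))

theorem opToSpan_comp_spanToCorel :
    P.opToSpan ≫ P.spanToCorel = P.opToCospan ≫ P.cospanToCorel :=
  hom_ext fun {a b} g => app_spanToCorel (P := P) (a := a) (b := b) (f := g) (g := P.id b)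
    (i := P.id a) (j := g) (IsPushout.id_vert (P.ar (a := b) (b := a) g))

instance : Epi P.spanToRel where
  left_cancellation _ _ h :=
    spanProp_hom_ext (congrArg (P.homToSpan ≫ ·) h) (congrArg (P.opToSpan ≫ ·) h)

instance : Epi P.cospanToCorel := inferInstanceAs (Epi P.op.spanToRel)

section Desc

variable {α : P.Span ⟶ X} {β : P.Cospan ⟶ X}

theorem homToCospan_comp_opToCospan_of_mono (hom : P.homToSpan ≫ α = P.homToCospan ≫ β)
    (op : P.opToSpan ≫ α = P.opToCospan ≫ β) {a b : ℕ} (m : P.Hom a b) [Mono (P.ar m)] :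
    X.comp (app (P.homToCospan ≫ β) m) (appOp (P.opToCospan ≫ β) m) = X.id a := by
  rw [← hom, ← op]
  exact ((spanRelations_spanOfHom_spanOfOp
    (MorphismProperty.isomorphisms P.Ob)).postcomp α).comp_eq_id_of_mono m

theorem spanRelations_op_epimorphisms (hom : P.homToSpan ≫ α = P.homToCospan ≫ β)
    (op : P.opToSpan ≫ α = P.opToCospan ≫ β) :
    SpanRelations (P := P.op) (MorphismProperty.epimorphisms P.op.Ob) (P.opToCospan ≫ β)
      (P.homToCospan ≫ β) where
  comp_eq_of_isPullback :=
    ((spanRelations_spanOfHom_spanOfOp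
      (MorphismProperty.isomorphisms P.op.Ob)).postcomp β).comp_eq_of_isPullback
  comp_eq_id_of_prop {a b} m hm := by
    have : Mono (P.ar (a := b) (b := a) m) := mono_of_epi_op (P := P) (a := b) (b := a) m hm
    exact homToCospan_comp_opToCospan_of_mono hom op (a := b) (b := a) m

/-- The morphism out of corelations induced by morphisms out of spans and cospans that agree on the
arrows of `P` and on those of its opposite. -/
noncomputable def corelDesc (hom : P.homToSpan ≫ α = P.homToCospan ≫ β)
    (op : P.opToSpan ≫ α = P.opToCospan ≫ β) : P.Corel ⟶ X :=
  (spanRelations_op_epimorphisms hom op).desc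

variable (hom : P.homToSpan ≫ α = P.homToCospan ≫ β) (op : P.opToSpan ≫ α = P.opToCospan ≫ β)

theorem cospanToCorel_corelDesc : P.cospanToCorel ≫ corelDesc hom op = β :=
  spanProp_hom_ext (P := P.op) (spanRelations_op_epimorphisms hom op).spanOfHom_desc
    (spanRelations_op_epimorphisms hom op).spanOfOp_desc

theorem spanToCorel_corelDesc : P.spanToCorel ≫ corelDesc hom op = α := by
  refine spanProp_hom_ext (?_ : P.homToSpan ≫ _ = P.homToSpan ≫ _)
    (?_ : P.opToSpan ≫ _ = P.opToSpan ≫ _)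
  · rw [← Category.assoc, homToSpan_comp_spanToCorel, Category.assoc, cospanToCorel_corelDesc, hom]
  · rw [← Category.assoc, opToSpan_comp_spanToCorel, Category.assoc, cospanToCorel_corelDesc, op]

end Desc

theorem isPushout_spanToCorel_cospanToCorel :
    IsPushout (coprod.desc P.homToSpan P.opToSpan : P ⨿ P.op ⟶ P.Span)
      (coprod.desc P.homToCospan P.opToCospan : P ⨿ P.op ⟶ P.Cospan)
      P.spanToCorel P.cospanToCorel := by
  have agree (s : PushoutCocone (coprod.desc P.homToSpan P.opToSpan)
      (coprod.desc P.homToCospan P.opToCospan)) := coprod_desc_comp_eq_iff.1 s.condition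
  refine ⟨⟨coprod_desc_comp_eq_iff.2 ⟨homToSpan_comp_spanToCorel, opToSpan_comp_spanToCorel⟩⟩,
    ⟨PushoutCocone.IsColimit.mk _ (fun s => corelDesc (agree s).1 (agree s).2)
      (fun s => spanToCorel_corelDesc _ _) (fun s => cospanToCorel_corelDesc _ _)
      fun s m _ hm => ?_⟩⟩
  rw [← cancel_epi P.cospanToCorel, hm, cospanToCorel_corelDesc]

variable (P)

/-- The comparison morphism from corelations to relations. The morphisms from spans and cospans to
relations are those from cospans and spans to corelations for the opposite prop, hence they agree
on the generators. -/
noncomputable def corelToRel : P.Corel ⟶ P.Rel :=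
  corelDesc (α := P.spanToRel) (β := P.cospanToRel) (opToSpan_comp_spanToCorel (P := P.op)).symm
    (homToSpan_comp_spanToCorel (P := P.op)).symm

theorem spanToCorel_corelToRel : P.spanToCorel ≫ P.corelToRel = P.spanToRel :=
  spanToCorel_corelDesc _ _

theorem cospanToCorel_corelToRel : P.cospanToCorel ≫ P.corelToRel = P.cospanToRel :=
  cospanToCorel_corelDesc _ _

/-- The comparison morphism from relations to corelations, as the dual of `corelToRel`. -/
noncomputable def relToCorel : P.Rel ⟶ P.Corel := P.op.corelToRel

theorem cospanToRel_relToCorel : P.cospanToRel ≫ P.relToCorel = P.cospanToCorel :=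
  P.op.spanToCorel_corelToRel

theorem corelToRel_relToCorel : P.corelToRel ≫ P.relToCorel = 𝟙 P.Corel := by
  rw [← cancel_epi P.cospanToCorel, ← Category.assoc, cospanToCorel_corelToRel,
    cospanToRel_relToCorel, Category.comp_id]

/-- The isomorphism between the props of corelations and of relations of an abelian prop. -/
noncomputable def corelIsoRel : P.Corel ≅ P.Rel where
  hom := P.corelToRel
  inv := P.relToCorel
  hom_inv_id := P.corelToRel_relToCorel
  inv_hom_id := P.op.corelToRel_relToCorel

end CorelPushout

end PROP

theorem mainTheorem7 (C : PROP.{v}) [C.IsAbelian] :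
    IsPushout (coprod.desc C.homToSpan C.opToSpan : C ⨿ C.op ⟶ C.Span)
      (coprod.desc C.homToCospan C.opToCospan : C ⨿ C.op ⟶ C.Cospan)
      C.spanToCorel C.cospanToCorel ∧
    ∃ e : C.Corel ≅ C.Rel,
      C.spanToCorel ≫ e.hom = C.spanToRel ∧ C.cospanToCorel ≫ e.hom = C.cospanToRel :=
  ⟨PROP.isPushout_spanToCorel_cospanToCorel, C.corelIsoRel, C.spanToCorel_corelToRel,
    C.cospanToCorel_corelToRel⟩
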